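/- Let $n$ and $k$ be integers with $1\le k\le n-1$. The enhanced hypercube $Q_{n,k}$ is the simple graph whose vertices are the binary strings $x_1x_2\cdots x_n\in\{0,1\}^n$, where two strings $X=x_1\cdots x_n$ and $Y$ are adjacent if and only if either $Y$ is obtained from $X$ by complementing exactly one bit $x_i$ ($1\le i\le n$), or $Y$ is obtained from $X$ by complementing exactly the bits $x_k,x_{k+1},\dots,x_n$. For a finite connected graph $\Gamma$, let $Kf(\Gamma)=\sum_{\{a,b\}} r_{ab}$ be its Kirchhoff index, where the sum is over all unordered pairs of distinct vertices and $r_{ab}$ is the effective resistance between $a$ and $b$ when every edge of $\Gamma$ is a unit resistor. Then $$\sum_{t=1}^{n}\frac{2^{t}-1}{t+1}\;\le\;\frac{Kf(Q_{n,k})}{2^{n-1}}\;\le\;\sum_{t=1}^{n-2}\frac{2^{t}-1}{t}+3\,\frac{(n-2)2^{n-1}+1}{n(n-1)},$$ where the sum on the right is empty (equal to $0$) for $n=2$. -/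

import Mathlib

/-- Ohm's law and Kirchhoff's current law in the electrical network on `G` in which every edge is a
unit resistor: `v` is a vertex potential for which a unit current enters at `a` and leaves at `b`.
The current from `x` to a neighbour `y` is `v x - v y`, so that at each vertex `x` the total current
flowing out along the edges is the current injected at `x` from outside. -/
def IsUnitCurrentPotential {V : Type*} [Fintype V] (G : SimpleGraph V) (a b : V) (v : V → ℝ) :
    Prop :=
  open Classical in
  ∀ x : V, ∑ y ∈ Finset.univ.filter (fun y => G.Adj x y), (v x - v y) =
    (if x = a then (1 : ℝ) else 0) - (if x = b then (1 : ℝ) else 0)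

open Classical in
/-- The resistance distance (effective resistance) between `a` and `b`: the potential difference
`v a - v b` when a unit current enters at `a` and leaves at `b`. In a connected graph such a
potential exists, and the difference does not depend on which one is taken (see
`IsUnitCurrentPotential.resistanceDist_eq` and `exists_isUnitCurrentPotential`); it is `0` by
convention if no such potential exists. -/
noncomputable def resistanceDist {V : Type*} [Fintype V] (G : SimpleGraph V) (a b : V) : ℝ :=
  if h : ∃ v : V → ℝ, IsUnitCurrentPotential G a b v then h.choose a - h.choose b else 0

/-- The Kirchhoff index: the sum of the resistance distances over all unordered pairs of distinct
vertices, written as half the sum over all ordered pairs (diagonal terms vanish). -/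
noncomputable def kirchhoffIndex {V : Type*} [Fintype V] (G : SimpleGraph V) : ℝ :=
  (∑ a : V, ∑ b : V, resistanceDist G a b) / 2

/-- The enhanced hypercube `Q_{n,k}` (for `1 ≤ k ≤ n - 1`) on binary strings `x₁ ⋯ xₙ`, where `xᵢ`
is `X ⟨i - 1, _⟩`. Two strings are adjacent if they differ by complementing exactly one bit, or by
complementing exactly the bits `x_k, …, x_n`. -/
def enhancedHypercube (n k : ℕ) : SimpleGraph (Fin n → Bool) :=
  SimpleGraph.fromRel fun X Y =>
    (∃ i : Fin n, Y = Function.update X i (!X i)) ∨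
      Y = fun j : Fin n => if k ≤ (j : ℕ) + 1 then !X j else X j

/-- For the admissible `n, k` adjacency is exactly the defining relation. -/
theorem enhancedHypercube_adj {n k : ℕ} (hkn : k ≤ n - 1) (hk : 1 ≤ k) (X Y : Fin n → Bool) :
    (enhancedHypercube n k).Adj X Y ↔
      ((∃ i : Fin n, Y = Function.update X i (!X i)) ∨
        Y = fun j : Fin n => if k ≤ (j : ℕ) + 1 then !X j else X j) := by
  have hsymm : ∀ X Y : Fin n → Bool,
      ((∃ i : Fin n, Y = Function.update X i (!X i)) ∨
        Y = fun j : Fin n => if k ≤ (j : ℕ) + 1 then !X j else X j) →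
      ((∃ i : Fin n, X = Function.update Y i (!Y i)) ∨
        X = fun j : Fin n => if k ≤ (j : ℕ) + 1 then !Y j else Y j) := by
    rintro X Y (⟨i, rfl⟩ | rfl)
    · exact Or.inl ⟨i, by simp⟩
    · right
      funext j
      by_cases h : k ≤ (j : ℕ) + 1 <;> simp [h]
  rw [enhancedHypercube, SimpleGraph.fromRel_adj]
  constructor
  · rintro ⟨-, h | h⟩
    · exact h
    · exact hsymm _ _ h
  · intro h
    refine ⟨?_, Or.inl h⟩
    rintro rfl
    rcases h with ⟨i, h⟩ | h
    · have := congrFun h i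
      simp at this
    · have := congrFun h ⟨n - 1, by omega⟩
      have hk' : k ≤ n - 1 + 1 := by omega
      simp [hk'] at this

/-- The enhanced hypercube is connected. -/
theorem enhancedHypercube_connected {n k : ℕ} : (enhancedHypercube n k).Connected := by
  have key : ∀ (s : Finset (Fin n)) (X : Fin n → Bool),
      (enhancedHypercube n k).Reachable X (fun j => if j ∈ s then !X j else X j) := by
    intro s X
    induction s using Finset.induction_on with
    | empty => simp
    | insert i s hi ih =>
      refine ih.trans (SimpleGraph.Adj.reachable ?_)
      rw [enhancedHypercube, SimpleGraph.fromRel_adj]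
      refine ⟨fun h => ?_, Or.inl (Or.inl ⟨i, ?_⟩)⟩
      · have := congrFun h i
        simp [hi] at this
      · funext j
        by_cases h : j = i
        · subst h; simp [hi]
        · simp [h]
  refine { preconnected := fun X Y => ?_, nonempty := ⟨fun _ => false⟩ }
  have h := key (Finset.univ.filter fun j => X j ≠ Y j) X
  convert h using 1
  funext j
  cases hX : X j <;> cases hY : Y j <;> simp [hX, hY]

theorem isUnitCurrentPotential_iff {V : Type*} [Fintype V] [DecidableEq V] (G : SimpleGraph V)
    [DecidableRel G.Adj] (a b : V) (v : V → ℝ) :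
    IsUnitCurrentPotential G a b v ↔
      (G.lapMatrix ℝ).mulVec v = Pi.single a 1 - Pi.single b 1 := by
  rw [funext_iff]
  refine forall_congr' fun x => ?_
  rw [SimpleGraph.lapMatrix_mulVec_apply]
  have h : ∑ y ∈ G.neighborFinset x, (v x - v y) =
      (G.degree x : ℝ) * v x - ∑ y ∈ G.neighborFinset x, v y := by
    simp [Finset.sum_sub_distrib]
  rw [← h]
  have h2 : G.neighborFinset x = Finset.univ.filter (fun y => G.Adj x y) := by
    ext y; simp
  rw [h2]
  simp only [Pi.sub_apply, Pi.single_apply]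
  refine Eq.congr ?_ ?_
  · refine Finset.sum_congr ?_ fun _ _ => rfl
    ext y; simp
  · congr

/-- The potential difference does not depend on the choice of the potential. -/
theorem IsUnitCurrentPotential.resistanceDist_eq {V : Type*} [Fintype V] {G : SimpleGraph V}
    {a b : V} {v : V → ℝ} (hv : IsUnitCurrentPotential G a b v) :
    resistanceDist G a b = v a - v b := by
  classical
  have hex : ∃ v : V → ℝ, IsUnitCurrentPotential G a b v := ⟨v, hv⟩
  rw [resistanceDist, dif_pos hex]
  have hw := hex.choose_spec
  generalize hex.choose = w at hw
  rw [isUnitCurrentPotential_iff] at hv hw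
  have h1 : v ⬝ᵥ (G.lapMatrix ℝ).mulVec w = w ⬝ᵥ (G.lapMatrix ℝ).mulVec v := by
    rw [Matrix.dotProduct_mulVec, ← Matrix.mulVec_transpose, (G.isSymm_lapMatrix (R := ℝ)).eq,
      dotProduct_comm]
  rw [hv, hw] at h1
  simp only [dotProduct_sub, dotProduct_single, mul_one] at h1
  exact h1.symm

/-- In a connected graph the potential exists. -/
theorem exists_isUnitCurrentPotential {V : Type*} [Fintype V] {G : SimpleGraph V}
    (hG : G.Connected) (a b : V) : ∃ v : V → ℝ, IsUnitCurrentPotential G a b v := by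
  classical
  simp only [isUnitCurrentPotential_iff]
  have hsum : ∀ w : V → ℝ, ∑ x, (G.lapMatrix ℝ).mulVec w x = 0 := by
    intro w
    have h : (fun _ : V => (1 : ℝ)) ⬝ᵥ (G.lapMatrix ℝ).mulVec w = 0 := by
      rw [Matrix.dotProduct_mulVec, ← Matrix.mulVec_transpose,
        (G.isSymm_lapMatrix (R := ℝ)).eq, G.lapMatrix_mulVec_const_eq_zero, zero_dotProduct]
    simpa [dotProduct] using h
  have hN : (Fintype.card V : ℝ) ≠ 0 := by
    have := hG.nonempty
    exact_mod_cast Fintype.card_ne_zero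
  let f : (V → ℝ) →ₗ[ℝ] (V → ℝ) :=
    { toFun := fun w => (G.lapMatrix ℝ).mulVec w + fun _ => ∑ y, w y
      map_add' := fun u w => by
        funext x
        simp [Matrix.mulVec_add, Finset.sum_add_distrib]
        ring
      map_smul' := fun c w => by
        funext x
        simp [Matrix.mulVec_smul, Finset.mul_sum, mul_add] }
  have hf : ∀ w x, f w x = (G.lapMatrix ℝ).mulVec w x + ∑ y, w y := fun _ _ => rfl
  have hfs : ∀ w, ∑ x, f w x = Fintype.card V * ∑ y, w y := by
    intro w
    simp only [hf, Finset.sum_add_distrib, hsum]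
    simp
  have hinj : Function.Injective f := by
    rw [← LinearMap.ker_eq_bot, LinearMap.ker_eq_bot']
    intro w hw
    have h0 : ∑ y, w y = 0 := by
      have := hfs w
      rw [hw] at this
      simpa [hN] using this.symm
    have hL : (G.lapMatrix ℝ).mulVec w = 0 := by
      funext x
      have := hf w x
      rw [hw, h0] at this
      simpa using this.symm
    rw [G.lapMatrix_mulVec_eq_zero_iff_forall_reachable] at hL
    funext x
    have hc : ∑ y, w y = Fintype.card V * w x := by
      rw [Finset.sum_congr rfl fun y _ => hL y x (hG.preconnected y x)]
      simp
    rw [h0] at hc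
    simpa [hN] using hc.symm
  obtain ⟨v, hv⟩ := LinearMap.injective_iff_surjective.mp hinj
    (Pi.single a 1 - Pi.single b 1)
  have h0 : ∑ y, v y = 0 := by
    have := hfs v
    rw [hv] at this
    simpa [hN] using this.symm
  refine ⟨v, funext fun x => ?_⟩
  rw [← hv, hf, h0, add_zero]

/-! `Q_{n,k}` is a Cayley graph of the group of binary strings under xor, generated by the unit
strings and the tail string `t` with ones at positions `k, …, n`. Walsh functions diagonalize its
Laplacian, with eigenvalue `2|S| + 1 - walsh t S` at `S`. Hence `Kf / 2 ^ (n - 1)` is the sum of the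
reciprocals of `|S| + (1 - walsh t S) / 2` over nonempty `S` (`kirchhoffIndex_cayley`). This sum
decreases as `t` gains ones (`reciprocalSum_antitone`). Every tail lies between the string whose
only ones are the last two bits and the all-ones string, so these two give the upper and lower
bounds. Their sums are evaluated by binomial identities (`reciprocalSum_pair`,
`reciprocalSum_true`). -/

open Finset

/-! ### Walsh functions and orthogonality -/

/-- The Walsh function of frequency `S` at `x`. -/
noncomputable def walsh {ι : Type*} (x : ι → Bool) (S : Finset ι) : ℝ :=
  ∏ i ∈ S, if x i then -1 else 1

section Walsh

variable {ι : Type*} (x y : ι → Bool) (S : Finset ι)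

@[simp] theorem walsh_empty : walsh x ∅ = 1 := by simp [walsh]

theorem walsh_xor : walsh (fun i => x i ^^ y i) S = walsh x S * walsh y S := by
  rw [walsh, walsh, walsh, ← prod_mul_distrib]
  refine prod_congr rfl fun i _ => ?_
  cases x i <;> cases y i <;> simp

theorem walsh_eq_or : walsh x S = 1 ∨ walsh x S = -1 := by
  classical
  induction S using Finset.induction_on with
  | empty => simp
  | insert i S hi ih =>
    have : walsh x (insert i S) = (if x i then -1 else 1) * walsh x S := prod_insert hi
    rw [this]
    rcases ih with h | h <;> rw [h] <;> split_ifs <;> simp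

theorem walsh_mul_self : walsh x S * walsh x S = 1 := by
  rcases walsh_eq_or x S with h | h <;> simp [h]

theorem walsh_true : walsh (fun _ : ι => true) S = (-1) ^ #S := by simp [walsh]

theorem sum_walsh_mul_pow [Fintype ι] (r : ℝ) :
    ∑ S, walsh x S * r ^ #S = ∏ i, (1 + (if x i then -1 else 1) * r) := by
  rw [prod_one_add, powerset_univ]
  refine sum_congr rfl fun S _ => ?_
  rw [prod_mul_distrib, prod_const, walsh]

theorem sum_walsh_freq [Fintype ι] :
    ∑ S, walsh x S = if x = fun _ => false then 2 ^ Fintype.card ι else 0 := by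
  have h := sum_walsh_mul_pow x 1
  simp only [one_pow, mul_one] at h
  rw [h]
  split_ifs with hx
  · subst hx
    norm_num
  · obtain ⟨i, hi⟩ := Function.ne_iff.mp hx
    refine prod_eq_zero (mem_univ i) ?_
    simp only [ne_eq, Bool.not_eq_false] at hi
    simp [hi]

theorem sum_walsh_mul_walsh [Fintype ι] :
    ∑ S, walsh x S * walsh y S = if x = y then 2 ^ Fintype.card ι else 0 := by
  simp only [← walsh_xor, sum_walsh_freq]
  congr 1
  simp [funext_iff]

theorem walsh_insert [DecidableEq ι] {i : ι} (hi : i ∉ S) :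
    walsh x (insert i S) = (if x i then -1 else 1) * walsh x S := prod_insert hi

variable [DecidableEq ι]

theorem walsh_single (i : ι) :
    walsh (fun j => decide (j = i)) S = if i ∈ S then -1 else 1 := by
  simp [walsh]

variable [Fintype ι]

theorem sum_xor (g : (ι → Bool) → ℝ) :
    ∑ x : ι → Bool, g (fun i => x i ^^ y i) = ∑ x, g x := by
  have hinv : Function.Involutive fun (x : ι → Bool) i => x i ^^ y i := fun x => by
    funext i; simp
  exact Equiv.sum_comp hinv.toPerm g

variable {S} in
theorem sum_walsh (hS : S.Nonempty) : ∑ x : ι → Bool, walsh x S = 0 := by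
  obtain ⟨i, hi⟩ := hS
  -- Translating by a single bit of `S` flips the sign of the summand, so the sum is its own
  -- negative.
  have h := sum_xor (fun j => decide (j = i)) fun x => walsh x S
  simp only [walsh_xor, walsh_single, hi, if_true, ← sum_mul] at h
  linarith

end Walsh

/-! ### Resistances in Cayley graphs of binary strings -/

section Cayley

variable {ι : Type*} [Fintype ι] [DecidableEq ι] {G : SimpleGraph (ι → Bool)}
  {D : Finset (ι → Bool)}

/-- The Laplacian eigenvalue of a Walsh function on the Cayley graph with connection set `D`. -/
noncomputable def cayleyEigenvalue (D : Finset (ι → Bool)) (S : Finset ι) : ℝ :=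
  ∑ d ∈ D, (1 - walsh d S)

theorem sum_cayley_neighbors [DecidableRel G.Adj]
    (hG : ∀ x y, G.Adj x y ↔ ∃ d ∈ D, y = fun i => x i ^^ d i)
    (x : ι → Bool) (g : (ι → Bool) → ℝ) :
    ∑ y ∈ univ.filter (fun y => G.Adj x y), g y = ∑ d ∈ D, g (fun i => x i ^^ d i) := by
  have h : univ.filter (fun y => G.Adj x y) = D.image fun d i => x i ^^ d i := by
    ext y
    simp [hG, eq_comm]
  rw [h, sum_image]
  intro d _ e _ hde
  funext i
  simpa using congrFun hde i

/-- By orthogonality the source `δ_a - δ_b` has Walsh coefficients `(walsh a S - walsh b S) / 2 ^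
|ι|`; dividing each by its eigenvalue inverts the Laplacian. At `S = ∅` the coefficient is zero. -/
theorem isUnitCurrentPotential_cayley
    (hG : ∀ x y, G.Adj x y ↔ ∃ d ∈ D, y = fun i => x i ^^ d i)
    (hD : ∀ S : Finset ι, S.Nonempty → cayleyEigenvalue D S ≠ 0) (a b : ι → Bool) :
    IsUnitCurrentPotential G a b fun x => ∑ S,
      (walsh a S - walsh b S) * (2 ^ Fintype.card ι * cayleyEigenvalue D S)⁻¹ * walsh x S := by
  classical
  intro x
  rw [sum_cayley_neighbors hG x (fun y => (∑ S, (walsh a S - walsh b S) *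
    (2 ^ Fintype.card ι * cayleyEigenvalue D S)⁻¹ * walsh x S) - ∑ S, (walsh a S - walsh b S) *
    (2 ^ Fintype.card ι * cayleyEigenvalue D S)⁻¹ * walsh y S)]
  simp only [← sum_sub_distrib]
  rw [sum_comm]
  have hterm : ∀ S : Finset ι, ∑ d ∈ D, ((walsh a S - walsh b S) *
      (2 ^ Fintype.card ι * cayleyEigenvalue D S)⁻¹ * walsh x S - (walsh a S - walsh b S) *
      (2 ^ Fintype.card ι * cayleyEigenvalue D S)⁻¹ * walsh (fun i => x i ^^ d i) S) =
      (2 ^ Fintype.card ι)⁻¹ * (walsh x S * walsh a S - walsh x S * walsh b S) := by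
    intro S
    rcases S.eq_empty_or_nonempty with rfl | hS
    · simp
    · have : ∀ d, (walsh a S - walsh b S) *
          (2 ^ Fintype.card ι * cayleyEigenvalue D S)⁻¹ * walsh x S - (walsh a S - walsh b S) *
          (2 ^ Fintype.card ι * cayleyEigenvalue D S)⁻¹ * walsh (fun i => x i ^^ d i) S =
          (walsh a S - walsh b S) * (2 ^ Fintype.card ι * cayleyEigenvalue D S)⁻¹ * walsh x S *
            (1 - walsh d S) := by
        intro d
        rw [walsh_xor]; ring
      simp only [this]
      rw [← mul_sum]
      change _ * cayleyEigenvalue D S = _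
      have := hD S hS
      field_simp
  rw [sum_congr rfl fun S _ => hterm S, ← mul_sum, sum_sub_distrib, sum_walsh_mul_walsh,
    sum_walsh_mul_walsh, mul_sub]
  have h2 : (2 : ℝ) ^ Fintype.card ι ≠ 0 := by positivity
  congr 1 <;> simp [h2]

/-- The resistance has Walsh terms `(walsh a S - walsh b S) ^ 2 = 2 - 2 * (walsh a S * walsh b S)`,
whose product part averages to zero over `a, b` for nonempty `S`. The term `S = ∅` drops out through
`0⁻¹ = 0`. -/
theorem kirchhoffIndex_cayley
    (hG : ∀ x y, G.Adj x y ↔ ∃ d ∈ D, y = fun i => x i ^^ d i)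
    (hD : ∀ S : Finset ι, S.Nonempty → cayleyEigenvalue D S ≠ 0) :
    kirchhoffIndex G = 2 ^ Fintype.card ι * ∑ S, (cayleyEigenvalue D S)⁻¹ := by
  have hr : ∀ a b, resistanceDist G a b = ∑ S,
      (2 ^ Fintype.card ι * cayleyEigenvalue D S)⁻¹ * (2 - 2 * (walsh a S * walsh b S)) := by
    intro a b
    rw [(isUnitCurrentPotential_cayley hG hD a b).resistanceDist_eq, ← sum_sub_distrib]
    refine sum_congr rfl fun S _ => ?_
    linear_combination (2 ^ Fintype.card ι * cayleyEigenvalue D S)⁻¹ *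
      (walsh_mul_self a S + walsh_mul_self b S)
  have hsum : ∀ S : Finset ι, S.Nonempty →
      ∑ a : ι → Bool, ∑ b : ι → Bool, (2 - 2 * (walsh a S * walsh b S)) =
        2 * 2 ^ Fintype.card ι * 2 ^ Fintype.card ι := by
    intro S hS
    simp only [sum_sub_distrib, ← mul_sum, sum_walsh hS]
    simp
    ring
  have hzero : cayleyEigenvalue D ∅ = 0 := by simp [cayleyEigenvalue]
  have hcomm : ∑ a, ∑ b, resistanceDist G a b = ∑ S,
      (2 ^ Fintype.card ι * cayleyEigenvalue D S)⁻¹ *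
        ∑ a : ι → Bool, ∑ b : ι → Bool, (2 - 2 * (walsh a S * walsh b S)) := by
    simp only [hr, mul_sum]
    rw [sum_comm]
    conv_rhs => rw [sum_comm]
    rw [sum_comm]
    exact sum_congr rfl fun a _ => sum_comm
  rw [kirchhoffIndex, hcomm, mul_sum, sum_div]
  refine sum_congr rfl fun S _ => ?_
  rcases S.eq_empty_or_nonempty with rfl | hS
  · simp [hzero]
  · rw [hsum S hS]
    have := hD S hS
    field_simp

end Cayley

/-! ### Monotonicity of the reciprocal sum -/

section Weight

/-- The sum of the reciprocals of the nonzero values of `|S| + (1 - walsh t S) / 2`. -/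
noncomputable def reciprocalSum {ι : Type*} [Fintype ι] (t : ι → Bool) : ℝ :=
  ∑ S : Finset ι, ((#S : ℝ) + (1 - walsh t S) / 2)⁻¹

theorem integral_one_sub_mul_pow (s : ℕ) :
    ∫ x in (0 : ℝ)..1, (1 - x) * x ^ s = ((s : ℝ) + 1)⁻¹ - ((s : ℝ) + 2)⁻¹ := by
  have h : ∀ x : ℝ, (1 - x) * x ^ s = x ^ s - x ^ (s + 1) := fun x => by ring
  simp only [h]
  rw [intervalIntegral.integral_sub (by simp) (by simp), integral_pow, integral_pow]
  push_cast
  simp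
  ring

variable {ι : Type*} [Fintype ι]

/-- The difference of the sums is an integral over `[0, 1]` of a nonnegative multiple of the
difference of the generating functions `∏ (1 ± x)`. Passing from `t` to `u` only replaces factors `1
+ x` by `1 - x`. -/
theorem reciprocalSum_antitone {t u : ι → Bool} (htu : t ≤ u) :
    reciprocalSum u ≤ reciprocalSum t := by
  classical
  -- The integral of `(1 - x) * x ^ (#S - 1)` is the gap between `1 / #S` and `1 / (#S + 1)`, the
  -- only two possible values. For `S = ∅` the coefficient vanishes, so the truncated exponent is
  -- harmless.
  have hterm : ∀ S : Finset ι, ((#S : ℝ) + (1 - walsh t S) / 2)⁻¹ -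
      ((#S : ℝ) + (1 - walsh u S) / 2)⁻¹ =
      ∫ x in (0 : ℝ)..1, (walsh t S - walsh u S) / 2 * ((1 - x) * x ^ (#S - 1)) := by
    intro S
    rcases S.eq_empty_or_nonempty with rfl | hS
    · simp
    · obtain ⟨s, hs⟩ := Nat.exists_eq_succ_of_ne_zero hS.card_pos.ne'
      rw [intervalIntegral.integral_const_mul, hs, Nat.succ_sub_one, integral_one_sub_mul_pow]
      rcases walsh_eq_or t S with h | h <;> rcases walsh_eq_or u S with h' | h' <;>
        rw [h, h'] <;> push_cast <;> ring
  rw [← sub_nonneg, reciprocalSum, reciprocalSum, ← sum_sub_distrib,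
    sum_congr rfl fun S _ => hterm S, ← intervalIntegral.integral_finsetSum]
  · rw [intervalIntegral.integral_of_le zero_le_one]
    refine MeasureTheory.setIntegral_nonneg measurableSet_Ioc fun x hx => ?_
    have hxt : x * ∑ S, (walsh t S - walsh u S) / 2 * ((1 - x) * x ^ (#S - 1)) =
        (1 - x) / 2 * (∑ S, walsh t S * x ^ #S - ∑ S, walsh u S * x ^ #S) := by
      rw [← sum_sub_distrib, mul_sum, mul_sum]
      refine sum_congr rfl fun S _ => ?_
      rcases S.eq_empty_or_nonempty with rfl | hS
      · simp
      · rw [← mul_pow_sub_one hS.card_pos.ne' x]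
        ring
    refine nonneg_of_mul_nonneg_right ?_ hx.1
    rw [hxt, sum_walsh_mul_pow, sum_walsh_mul_pow]
    refine mul_nonneg (by linarith [hx.2]) (sub_nonneg.mpr (prod_le_prod ?_ ?_))
    · intro i _
      split_ifs <;> linarith [hx.1, hx.2]
    · intro i _
      have hi : t i → u i := Bool.le_iff_imp.mp (htu i)
      have := hx.1
      split_ifs with hu ht ht
      · rfl
      · linarith
      · exact absurd (hi ht) hu
      · rfl
  · intro S _
    exact Continuous.intervalIntegrable (by fun_prop) _ _

/-! ### Binomial sums with reciprocal weights -/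

theorem sum_choose_mul_pow (N : ℕ) (z : ℝ) :
    ∑ j ∈ range (N + 1), (N.choose j : ℝ) * z ^ j = (z + 1) ^ N := by
  rw [add_pow]
  exact sum_congr rfl fun j _ => by rw [one_pow]; ring

theorem sum_choose_succ_mul_pow (N : ℕ) (z : ℝ) :
    z * ∑ j ∈ range (N + 1), ((N + 1).choose (j + 1) : ℝ) * z ^ j = (z + 1) ^ (N + 1) - 1 := by
  rw [← sum_choose_mul_pow (N + 1), sum_range_succ' _ (N + 1), mul_sum]
  simp only [Nat.choose_zero_right, Nat.cast_one, pow_zero, mul_one, add_sub_cancel_right]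
  exact sum_congr rfl fun j _ => by ring

theorem sum_choose_add_two_mul_pow (N : ℕ) (z : ℝ) :
    z ^ 2 * ∑ j ∈ range (N + 1), ((N + 2).choose (j + 2) : ℝ) * z ^ j =
      (z + 1) ^ (N + 2) - 1 - (N + 2) * z := by
  rw [← sum_choose_mul_pow (N + 2), sum_range_succ' _ (N + 2), sum_range_succ' _ (N + 1), mul_sum]
  simp only [Nat.choose_zero_right, Nat.cast_one, pow_zero, mul_one, zero_add,
    Nat.choose_one_right, pow_one]
  push_cast
  rw [add_sub_cancel_right, add_sub_cancel_right]
  exact sum_congr rfl fun j _ => by ring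

theorem choose_mul_inv_add_one (N j : ℕ) :
    (N.choose j : ℝ) * ((j : ℝ) + 1)⁻¹ = ((N : ℝ) + 1)⁻¹ * (N + 1).choose (j + 1) := by
  have h : ((N : ℝ) + 1) * N.choose j = (N + 1).choose (j + 1) * ((j : ℝ) + 1) := by
    exact_mod_cast Nat.add_one_mul_choose_eq N j
  field_simp
  linarith

theorem choose_mul_inv_add_two (N j : ℕ) :
    (N.choose j : ℝ) * ((j : ℝ) + 2)⁻¹ = ((N : ℝ) + 1)⁻¹ * (N + 1).choose (j + 1) -
      (((N : ℝ) + 1) * (N + 2))⁻¹ * (N + 2).choose (j + 2) := by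
  have h1 := choose_mul_inv_add_one N j
  have h2 := choose_mul_inv_add_one (N + 1) (j + 1)
  push_cast at h2
  rw [add_assoc, add_assoc, one_add_one_eq_two] at h2
  -- Partial fractions make room for absorbing `1 / (j + 1)` and then `1 / (j + 2)` into the
  -- binomial coefficient.
  have h : (N.choose j : ℝ) * ((j : ℝ) + 2)⁻¹ = N.choose j * ((j : ℝ) + 1)⁻¹ -
      N.choose j * ((j : ℝ) + 1)⁻¹ * ((j : ℝ) + 2)⁻¹ := by
    field_simp
    ring
  rw [h, h1, mul_assoc, h2, mul_inv]
  ring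

theorem sum_choose_mul_inv_add_one (N : ℕ) :
    ∑ j ∈ range (N + 1), (N.choose j : ℝ) * ((j : ℝ) + 1)⁻¹ =
      ((2 : ℝ) ^ (N + 1) - 1) / ((N : ℝ) + 1) := by
  have h := sum_choose_succ_mul_pow N 1
  simp only [one_pow, mul_one, one_mul, one_add_one_eq_two] at h
  simp only [choose_mul_inv_add_one]
  rw [← mul_sum, h]
  ring

theorem sum_choose_mul_inv_add_two (N : ℕ) :
    ∑ j ∈ range (N + 1), (N.choose j : ℝ) * ((j : ℝ) + 2)⁻¹ =
      ((N : ℝ) * 2 ^ (N + 1) + 1) / (((N : ℝ) + 2) * (N + 1)) := by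
  have h := sum_choose_succ_mul_pow N 1
  have h' := sum_choose_add_two_mul_pow N 1
  simp only [one_pow, mul_one, one_mul, one_add_one_eq_two] at h h'
  simp only [choose_mul_inv_add_two]
  rw [sum_sub_distrib, ← mul_sum, ← mul_sum, h, h']
  field_simp
  ring

theorem sum_choose_succ_mul (N : ℕ) (f : ℕ → ℝ) :
    ∑ j ∈ range (N + 2), ((N + 1).choose j : ℝ) * f j =
      ∑ j ∈ range (N + 1), (N.choose j : ℝ) * f j +
        ∑ j ∈ range (N + 1), (N.choose j : ℝ) * f (j + 1) := by
  rw [sum_range_succ']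
  simp only [Nat.choose_succ_succ, Nat.cast_add, add_mul, sum_add_distrib]
  have h : ∑ j ∈ range (N + 1), (N.choose (j + 1) : ℝ) * f (j + 1) + N.choose 0 * f 0 =
      ∑ j ∈ range (N + 1), (N.choose j : ℝ) * f j := by
    rw [← sum_range_succ' (fun j => (N.choose j : ℝ) * f j), sum_range_succ]
    simp
  rw [← h]
  simp
  ring

/-- By Pascal's rule, raising `N` adds the same sum with shifted weight, which is one summand on the
right. The `j = 0` term is `0⁻¹ = 0`. -/
theorem sum_choose_mul_inv (N : ℕ) :
    ∑ j ∈ range (N + 1), (N.choose j : ℝ) * (j : ℝ)⁻¹ =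
      ∑ t ∈ Icc 1 N, ((2 : ℝ) ^ t - 1) / (t : ℝ) := by
  induction N with
  | zero => simp
  | succ N ih =>
    rw [sum_choose_succ_mul N fun j => (j : ℝ)⁻¹, ih, sum_Icc_succ_top (by omega)]
    push_cast
    rw [sum_choose_mul_inv_add_one]

theorem sum_choose_mul_inv_add_parity (N : ℕ) :
    ∑ j ∈ range (N + 1), (N.choose j : ℝ) * ((j : ℝ) + (1 - (-1) ^ j) / 2)⁻¹ =
      ∑ t ∈ Icc 1 N, ((2 : ℝ) ^ t - 1) / ((t : ℝ) + 1) := by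
  induction N with
  | zero => simp
  | succ N ih =>
    rw [sum_choose_succ_mul N fun j => ((j : ℝ) + (1 - (-1) ^ j) / 2)⁻¹, ih,
      sum_Icc_succ_top (by omega), add_right_inj]
    -- The shifted denominator is `j + 2` for even `j` and `j + 1` for odd `j`. The correction term,
    -- present only for even `j`, is selected by `(1 + (-1) ^ j) / 2` and summed by evaluating at
    -- `1` and `-1`.
    have hterm : ∀ j : ℕ, (N.choose j : ℝ) *
        (((j + 1 : ℕ) : ℝ) + (1 - (-1) ^ (j + 1)) / 2)⁻¹ =
        ((N : ℝ) + 1)⁻¹ * (N + 1).choose (j + 1) - (((N : ℝ) + 1) * (N + 2))⁻¹ / 2 *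
          ((N + 2).choose (j + 2) + (N + 2).choose (j + 2) * (-1) ^ j) := by
      intro j
      rcases neg_one_pow_eq_or ℝ j with h | h
      · have := choose_mul_inv_add_two N j
        rw [pow_succ, h]
        push_cast
        rw [show (j : ℝ) + 1 + (1 - 1 * -1) / 2 = j + 2 by ring, this]
        ring
      · have := choose_mul_inv_add_one N j
        rw [pow_succ, h]
        push_cast
        rw [show (j : ℝ) + 1 + (1 - -1 * -1) / 2 = j + 1 by ring, this]
        ring
    have h := sum_choose_succ_mul_pow N 1
    have h' := sum_choose_add_two_mul_pow N 1
    have h'' := sum_choose_add_two_mul_pow N (-1)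
    simp only [one_pow, mul_one, one_mul, one_add_one_eq_two] at h h'
    rw [neg_one_sq, one_mul, neg_add_cancel, zero_pow (by omega)] at h''
    rw [sum_congr rfl fun j _ => hterm j, sum_sub_distrib, ← mul_sum, ← mul_sum,
      sum_add_distrib, h, h', h'']
    push_cast
    field_simp
    ring

/-! ### The two extremal strings -/

theorem reciprocalSum_true :
    reciprocalSum (fun _ : ι => true) =
      ∑ t ∈ Icc 1 (Fintype.card ι), ((2 : ℝ) ^ t - 1) / ((t : ℝ) + 1) := by
  simp only [reciprocalSum, walsh_true]
  rw [← powerset_univ, sum_powerset_apply_card fun j => ((j : ℝ) + (1 - (-1) ^ j) / 2)⁻¹,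
    card_univ, ← sum_choose_mul_inv_add_parity]
  simp only [nsmul_eq_mul]

/-- Split by how `S` meets `{a, b}`, with `s` elements outside. If it misses both, the denominator
is `s`. With one of them it is `(s + 1) + 1` by the sign, with both it is `s + 2`: hence three equal
sums. -/
theorem reciprocalSum_pair [DecidableEq ι] {a b : ι} (hab : a ≠ b) {N : ℕ}
    (hN : Fintype.card ι = N + 2) :
    reciprocalSum (fun i => decide (i = a ∨ i = b)) =
      ∑ t ∈ Icc 1 N, ((2 : ℝ) ^ t - 1) / (t : ℝ) +
        3 * (((N : ℝ) * 2 ^ (N + 1) + 1) / (((N : ℝ) + 2) * (N + 1))) := by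
  set U : Finset ι := (univ.erase a).erase b with hU
  have haU : a ∉ insert b U := by simp [hU, hab]
  have hbU : b ∉ U := by simp [hU]
  have huniv : (univ : Finset ι) = insert a (insert b U) := by
    rw [hU, insert_erase (by simp [hab.symm]), insert_erase (mem_univ a)]
  have hcard : #U = N := by
    have := congrArg card huniv
    rw [card_insert_of_notMem haU, card_insert_of_notMem hbU, card_univ, hN] at this
    omega
  have hsub : ∀ S ∈ U.powerset, b ∉ S ∧ a ∉ S ∧ a ∉ insert b S ∧
      walsh (fun i => decide (i = a ∨ i = b)) S = 1 := by
    intro S hS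
    rw [mem_powerset] at hS
    have hb : b ∉ S := fun h => hbU (hS h)
    have ha : a ∉ S := fun h => haU (mem_insert_of_mem (hS h))
    refine ⟨hb, ha, by simp [hab, ha], prod_eq_one fun i hi => ?_⟩
    have h1 : i ≠ a := fun h => ha (h ▸ hi)
    have h2 : i ≠ b := fun h => hb (h ▸ hi)
    simp [h1, h2]
  rw [reciprocalSum, ← powerset_univ, huniv, sum_powerset_insert haU, sum_powerset_insert hbU,
    sum_powerset_insert hbU, ← sum_choose_mul_inv, ← sum_choose_mul_inv_add_two, ← hcard]
  have hc : ∀ f : ℕ → ℝ, ∑ j ∈ range (#U + 1), ((#U).choose j : ℝ) * f j =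
      ∑ S ∈ U.powerset, f #S := fun f => by
    rw [sum_powerset_apply_card]; simp only [nsmul_eq_mul]
  rw [hc fun j => (j : ℝ)⁻¹, hc fun j => ((j : ℝ) + 2)⁻¹, mul_sum, ← sum_add_distrib,
    ← sum_add_distrib, ← sum_add_distrib, ← sum_add_distrib]
  refine sum_congr rfl fun S hS => ?_
  obtain ⟨hb, ha, hab', hw⟩ := hsub S hS
  rw [walsh_insert _ _ hb, walsh_insert _ _ hab', walsh_insert _ _ hb, walsh_insert _ _ ha, hw,
    card_insert_of_notMem hb, card_insert_of_notMem hab', card_insert_of_notMem hb,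
    card_insert_of_notMem ha]
  simp only [true_or, or_true, decide_true, if_true]
  push_cast
  ring

end Weight

/-! ### The enhanced hypercube as a Cayley graph -/

section EnhancedHypercube

/-- The set of bits `x_k, …, x_n`. -/
def tailBits (n k : ℕ) : Fin n → Bool := fun j => decide (k ≤ (j : ℕ) + 1)

/-- The connection set of the enhanced hypercube. -/
def enhancedHypercubeGenerators (n k : ℕ) : Finset (Fin n → Bool) :=
  insert (tailBits n k) (univ.image fun i j => decide (j = i))

variable {n k : ℕ}

theorem enhancedHypercube_adj_iff_xor (hk : 1 ≤ k) (hkn : k ≤ n - 1) (x y : Fin n → Bool) :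
    (enhancedHypercube n k).Adj x y ↔
      ∃ d ∈ enhancedHypercubeGenerators n k, y = fun i => x i ^^ d i := by
  have h1 : ∀ i : Fin n, Function.update x i (!x i) = fun j => x j ^^ decide (j = i) := by
    intro i
    funext j
    by_cases h : j = i
    · subst h; simp
    · simp [h]
  have h2 : (fun j : Fin n => if k ≤ (j : ℕ) + 1 then !x j else x j) =
      fun j => x j ^^ tailBits n k j := by
    funext j
    by_cases h : k ≤ (j : ℕ) + 1 <;> simp [h, tailBits]
  rw [enhancedHypercube_adj hkn hk, h2]
  simp only [h1, enhancedHypercubeGenerators, mem_insert, mem_image, mem_univ, true_and,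
    exists_eq_or_imp, exists_exists_eq_and]
  exact or_comm

theorem cayleyEigenvalue_enhancedHypercube (hk : 1 ≤ k) (hkn : k ≤ n - 1) (S : Finset (Fin n)) :
    cayleyEigenvalue (enhancedHypercubeGenerators n k) S =
      2 * ((#S : ℝ) + (1 - walsh (tailBits n k) S) / 2) := by
  -- Since `k ≤ n - 1`, the tail contains the last two bits, so it is not a unit string.
  have hnot : tailBits n k ∉ univ.image fun (i j : Fin n) => decide (j = i) := by
    simp only [mem_image, mem_univ, true_and, not_exists]
    intro i h
    have h1 := congrFun h ⟨n - 1, by omega⟩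
    have h2 := congrFun h ⟨n - 2, by omega⟩
    have e1 : k ≤ n - 1 + 1 := by omega
    have e2 : k ≤ n - 2 + 1 := by omega
    simp only [tailBits, e1, e2, decide_true, decide_eq_true_eq, Fin.ext_iff] at h1 h2
    omega
  have hinj : Function.Injective fun (i j : Fin n) => decide (j = i) := fun i i' h => by
    simpa using congrFun h i
  rw [cayleyEigenvalue, enhancedHypercubeGenerators, sum_insert hnot, sum_image hinj.injOn]
  have h : ∀ i, 1 - walsh (fun j => decide (j = i)) S = if i ∈ S then 2 else 0 := by
    intro i
    rw [walsh_single]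
    split_ifs <;> norm_num
  simp only [h, sum_ite_mem, univ_inter, sum_const, nsmul_eq_mul]
  ring

theorem kirchhoffIndex_enhancedHypercube (hk : 1 ≤ k) (hkn : k ≤ n - 1) :
    kirchhoffIndex (enhancedHypercube n k) / 2 ^ (n - 1) = reciprocalSum (tailBits n k) := by
  rw [kirchhoffIndex_cayley (enhancedHypercube_adj_iff_xor hk hkn), Fintype.card_fin,
    reciprocalSum]
  · simp only [cayleyEigenvalue_enhancedHypercube hk hkn, mul_inv, ← mul_sum]
    rw [← mul_pow_sub_one (show n ≠ 0 by omega) (2 : ℝ)]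
    field_simp
  · intro S hS
    rw [cayleyEigenvalue_enhancedHypercube hk hkn]
    have : (0 : ℝ) < #S := by exact_mod_cast hS.card_pos
    rcases walsh_eq_or (tailBits n k) S with h | h <;> rw [h] <;> linarith

end EnhancedHypercube

theorem corollary6 (n k : ℕ) (hk : 1 ≤ k) (hkn : k ≤ n - 1) :
    ∑ t ∈ Finset.Icc 1 n, ((2 : ℝ) ^ t - 1) / ((t : ℝ) + 1) ≤
        kirchhoffIndex (enhancedHypercube n k) / (2 : ℝ) ^ (n - 1) ∧
      kirchhoffIndex (enhancedHypercube n k) / (2 : ℝ) ^ (n - 1) ≤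
        ∑ t ∈ Finset.Icc 1 (n - 2), ((2 : ℝ) ^ t - 1) / (t : ℝ) +
          3 * ((((n : ℝ) - 2) * (2 : ℝ) ^ (n - 1) + 1) / ((n : ℝ) * ((n : ℝ) - 1))) := by
  rw [kirchhoffIndex_enhancedHypercube hk hkn]
  constructor
  · have h := reciprocalSum_true (ι := Fin n)
    rw [Fintype.card_fin] at h
    rw [← h]
    exact reciprocalSum_antitone fun i => Bool.le_true _
  · obtain ⟨N, rfl⟩ : ∃ N, n = N + 2 := ⟨n - 2, by omega⟩
    have hab : (⟨N, by omega⟩ : Fin (N + 2)) ≠ ⟨N + 1, by omega⟩ := by simp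
    have h := reciprocalSum_pair hab (Fintype.card_fin _)
    have hle : (fun i : Fin (N + 2) => decide (i = ⟨N, by omega⟩ ∨ i = ⟨N + 1, by omega⟩)) ≤
        tailBits (N + 2) k := by
      intro i
      rw [Bool.le_iff_imp]
      simp only [tailBits, decide_eq_true_eq, Fin.ext_iff]
      omega
    refine (reciprocalSum_antitone hle).trans (h.trans ?_).le
    have e1 : N + 2 - 2 = N := by omega
    have e2 : N + 2 - 1 = N + 1 := by omega
    have e3 : ((N + 2 : ℕ) : ℝ) - 2 = N := by push_cast; ring
    have e4 : ((N + 2 : ℕ) : ℝ) - 1 = N + 1 := by push_cast; ring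
    rw [e1, e2, e3, e4]
    push_cast
    rfl
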